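/- Let $n\ge 1$, let $\mathbf Z_+^n$ be the set of $n$-tuples of nonnegative integers, and let $\mathbf e_k$ be the $k$-th unit vector. Let $(h_{\mathbf j})$, $(a_{\mathbf j})$ and $(b^{(k)}_{\mathbf j})$, $k=1,\dots,n$, be real families indexed by $\mathbf j\in\mathbf Z_+^n$ such that $h_{\mathbf j}\ge 0$ and $a_{\mathbf j}\ge 0$ for $\mathbf j\ne\mathbf 0$, $b^{(k)}_{\mathbf j}\ge 0$ for $\mathbf j\neq\mathbf e_k$, and $$0<\sum_{\mathbf j\ne\mathbf 0}h_{\mathbf j}=-h_{\mathbf 0}<\infty,\qquad 0<\sum_{\mathbf j\ne\mathbf 0}a_{\mathbf j}=-a_{\mathbf 0}<\infty,\qquad 0<\sum_{\mathbf j\ne\mathbf e_k}b^{(k)}_{\mathbf j}=-b^{(k)}_{\mathbf e_k}<\infty\quad(k=1,\dots,n).$$ Define the $n$-type branching with immigration $q$-matrix $Q=(q_{\mathbf i\mathbf j})_{\mathbf i,\mathbf j\in\mathbf Z_+^n}$ by $q_{\mathbf 0\mathbf j}=h_{\mathbf j}$ and, for $\mathbf i\ne\mathbf 0$, $$q_{\mathbf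 i\mathbf j}=\sum_{k=1}^n i_k\,b^{(k)}_{\mathbf j-\mathbf i+\mathbf e_k}+a_{\mathbf j-\mathbf i},$$ where terms whose index does not lie in $\mathbf Z_+^n$ are read as $0$. A (standard, possibly dishonest) transition function is a family $P(t)=(p_{\mathbf i\mathbf j}(t))$, $t\ge 0$, with $p_{\mathbf i\mathbf j}(t)\ge 0$, $\sum_{\mathbf j}p_{\mathbf i\mathbf j}(t)\le 1$, $p_{\mathbf i\mathbf j}(0)=\delta_{\mathbf i\mathbf j}$, $p_{\mathbf i\mathbf j}(s+t)=\sum_{\mathbf k}p_{\mathbf i\mathbf k}(s)p_{\mathbf k\mathbf j}(t)$ and $\lim_{t\downarrow 0}p_{\mathbf i\mathbf j}(t)=\delta_{\mathbf i\mathbf j}$. An $n$-type branching process with immigration ($n$TBIP) with $q$-matrix $Q$ is a transition function on $\mathbf Z_+^n$ satisfying the Kolmogorov forward equation $P'(t)=P(t)Q$, i.e. $p'_{\mathbf i\mathbf j}(t)=\sum_{\mathbf k}p_{\mathbf i\mathbf k}(t)q_{\mathbf k\mathbf j}$ with convergent series, for all $t\ge 0$ and all $\mathbf i,\mathbf j$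 (right derivative at $t=0$). The Feller minimal $Q$-process is $f_{\mathbf i\mathbf j}(t)=\lim_{m\to\infty}f^{(m)}_{\mathbf i\mathbf j}(t)$, where $f^{(0)}_{\mathbf i\mathbf j}(t)=\delta_{\mathbf i\mathbf j}e^{q_{\mathbf i\mathbf i}t}$ and $$f^{(m+1)}_{\mathbf i\mathbf j}(t)=\delta_{\mathbf i\mathbf j}e^{q_{\mathbf i\mathbf i}t}+\int_0^t e^{q_{\mathbf i\mathbf i}s}\sum_{\mathbf k\ne\mathbf i}q_{\mathbf i\mathbf k}f^{(m)}_{\mathbf k\mathbf j}(t-s)\,ds .$$ Theorem. For every such $Q$ there exists exactly one $n$TBIP with $q$-matrix $Q$, and it is the Feller minimal $Q$-process. -/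

import Mathlib

open scoped NNReal ENNReal Topology

noncomputable section

/-- The state space `ℤ₊ⁿ`. -/
abbrev NTState (n : ℕ) : Type := Fin n → ℕ

/-- The unit vector `e_k`. -/
def unitVec {n : ℕ} (k : Fin n) : NTState n := Pi.single k 1

/-- A family of rates `r`, distinguished at the point `x`: it is nonnegative off `x`, and
`0 < ∑_{j ≠ x} r_j = -r_x < ∞`. -/
def IsConservativeRate {S : Type*} (r : S → ℝ) (x : S) : Prop :=
  (∀ j, j ≠ x → 0 ≤ r j) ∧ 0 < -r x ∧ HasSum (fun j : {j : S // j ≠ x} => r j) (-r x)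

/-- The matrix built from resurrection rates `h`, immigration rates `a` and branching
rates `b`. The truncated differences are taken only where the true difference lies in `ℤ₊ⁿ`. -/
def ntbiMatrix {n : ℕ} (h a : NTState n → ℝ) (b : Fin n → NTState n → ℝ) :
    Matrix (NTState n) (NTState n) ℝ := fun i j =>
  if i = 0 then h j
  else (∑ k, (i k : ℝ) * (if ∀ l, i l ≤ (j + unitVec k) l then b k (j + unitVec k - i) else 0))
    + (if ∀ l, i l ≤ j l then a (j - i) else 0)

/-- `Q` is an `n`-type branching with immigration `q`-matrix. -/
def IsNTBIMatrix {n : ℕ} (Q : Matrix (NTState n) (NTState n) ℝ) : Prop :=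
  ∃ (h a : NTState n → ℝ) (b : Fin n → NTState n → ℝ),
    IsConservativeRate h 0 ∧ IsConservativeRate a 0 ∧
    (∀ k, IsConservativeRate (b k) (unitVec k)) ∧ Q = ntbiMatrix h a b

section General

variable {S : Type*} [DecidableEq S]

/-- A standard (possibly dishonest, i.e. substochastic) transition function on `S`. -/
structure IsTransitionFunction (P : ℝ≥0 → Matrix S S ℝ) : Prop where
  nonneg : ∀ t i j, 0 ≤ P t i j
  summable : ∀ t i, Summable (fun j => P t i j)
  tsum_le_one : ∀ t i, ∑' j, P t i j ≤ 1
  zero : P 0 = 1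
  chapman_kolmogorov : ∀ s t i j, P (s + t) i j = ∑' k, P s i k * P t k j
  standard : ∀ i j, Filter.Tendsto (fun t => P t i j) (𝓝[>] 0) (𝓝 ((1 : Matrix S S ℝ) i j))

/-- The Kolmogorov forward equation `P'(t) = P(t) Q` for all `t ≥ 0`, entrywise, with
convergent series on the right; the derivative at `t = 0` is the right derivative. -/
def SatisfiesForwardEquation (Q : Matrix S S ℝ) (P : ℝ≥0 → Matrix S S ℝ) : Prop :=
  ∀ (t : ℝ≥0) (i j : S), Summable (fun k => P t i k * Q k j) ∧
    HasDerivWithinAt (fun s : ℝ => P s.toNNReal i j) (∑' k, P t i k * Q k j)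
      (Set.Ici 0) (t : ℝ)

/-- Feller's iterates for a conservative `q`-matrix `Q`: for `t ≥ 0`, `fellerIter Q m t i j`
is the probability of going from `i` to `j` in time `t` with at most `m` jumps:
`f⁽⁰⁾_{ij}(t) = δ_{ij} e^{q_{ii} t}` and
`f⁽ᵐ⁺¹⁾_{ij}(t) = δ_{ij} e^{q_{ii} t} + ∫₀ᵗ e^{q_{ii} s} ∑_{k ≠ i} q_{ik} f⁽ᵐ⁾_{kj}(t - s) ds`. -/
def fellerIter (Q : Matrix S S ℝ) : ℕ → ℝ → S → S → ℝ≥0∞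
  | 0 => fun t i j => if i = j then ENNReal.ofReal (Real.exp (Q i i * t)) else 0
  | m + 1 => fun t i j =>
      (if i = j then ENNReal.ofReal (Real.exp (Q i i * t)) else 0) +
      ∫⁻ s in Set.Icc (0 : ℝ) t, ENNReal.ofReal (Real.exp (Q i i * s)) *
        ∑' k : {k : S // k ≠ i}, ENNReal.ofReal (Q i k) * fellerIter Q m (t - s) k j

/-- The Feller minimal `Q`-process (transition function): the increasing limit of Feller's
iterates, that is, the minimal nonnegative solution of the backward integral equation. -/
def fellerMinimal (Q : Matrix S S ℝ) : ℝ≥0 → Matrix S S ℝ := fun t i j =>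
  (⨆ m, fellerIter Q m (t : ℝ) i j).toReal

end General

/-- `P` is (the transition function of) an `n`-type branching process with immigration with
`q`-matrix `Q`. -/
def IsNTBIP {n : ℕ} (Q : Matrix (NTState n) (NTState n) ℝ)
    (P : ℝ≥0 → Matrix (NTState n) (NTState n) ℝ) : Prop :=
  IsNTBIMatrix Q ∧ IsTransitionFunction P ∧ SatisfiesForwardEquation Q P

end

/-! A jump lowers the total population $w(i)=\sum_l i_l$ by at most one, and only through branching,
at total rate at most $c\,w(i)$ with $c=\sum_k -b^{(k)}_{\mathbf e_k}$. `IsLinearlySkipFree`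
isolates these properties; upward jumps are unrestricted, so explosion is allowed.

Existence. Only finitely many states lead to a given state, so columns of $Q$ have finite support.
Feller's iterates, defined by the first jump, also satisfy the last-jump recursion because the two
steps commute (`backwardStep_forwardStep`). The limit therefore solves a forward integral equation
with a finite sum inside, which can be differentiated.

Uniqueness (`forward_bound`, `eq_zero_of_forward`). The difference $D$ of corresponding rows of two
solutions starts at zero and has $\ell^1$ norm at most 2. The truncated generating function
$G_N(t,\sigma)=\sum_{w(j)\le N}|D_j(t)|\sigma^{w(j)}$ satisfies $\partial_t G_N\le
c(1-\sigma)\,\partial_\sigma G_N+2c(N+1)\sigma^N$, the last term being the inflow from weight $N+1$.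
Along the characteristic $\sigma'=-c(1-\sigma)$ the first term cancels, and the inflow vanishes as
$N\to\infty$ since $\sigma$ stays away from 1. Hence $D=0$. The same argument gives
Chapman–Kolmogorov for the minimal process. -/

noncomputable section

open MeasureTheory Set Filter

/-! ### First-jump and last-jump recursions for the Feller iterates. -/

section FellerIteration

variable {S : Type*}

/-- The transition function of the process killed at its first jump. -/
def diagExp [DecidableEq S] (Q : Matrix S S ℝ) (t : ℝ) (i j : S) : ℝ≥0∞ :=
  if i = j then ENNReal.ofReal (Real.exp (Q i i * t)) else 0

/-- Decomposition at the first jump. -/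
def backwardStep (Q : Matrix S S ℝ) (f : ℝ → S → S → ℝ≥0∞) (t : ℝ) (i j : S) : ℝ≥0∞ :=
  ∫⁻ s in Icc (0 : ℝ) t, ENNReal.ofReal (Real.exp (Q i i * s)) *
    ∑' k : {k : S // k ≠ i}, ENNReal.ofReal (Q i k) * f (t - s) k j

/-- Decomposition at the last jump. -/
def forwardStep (Q : Matrix S S ℝ) (f : ℝ → S → S → ℝ≥0∞) (t : ℝ) (i j : S) : ℝ≥0∞ :=
  ∫⁻ s in Icc (0 : ℝ) t, ENNReal.ofReal (Real.exp (Q j j * s)) *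
    ∑' k : {k : S // k ≠ j}, f (t - s) i k * ENNReal.ofReal (Q k j)

theorem fellerIter_zero [DecidableEq S] (Q : Matrix S S ℝ) : fellerIter Q 0 = diagExp Q := rfl

theorem fellerIter_succ [DecidableEq S] (Q : Matrix S S ℝ) (m : ℕ) :
    fellerIter Q (m + 1) = diagExp Q + backwardStep Q (fellerIter Q m) := rfl

theorem setLIntegral_Icc_eq_indicator (t : ℝ) (φ : ℝ → ℝ≥0∞) :
    ∫⁻ s in Icc (0 : ℝ) t, φ s = ∫⁻ s, (if 0 ≤ s ∧ s ≤ t then φ s else 0) := by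
  rw [← lintegral_indicator measurableSet_Icc]
  exact lintegral_congr fun s => by simp only [indicator_apply, mem_Icc]

theorem measurableSet_triangle {α : Type*} [MeasurableSpace α] {f g : α → ℝ}
    (hf : Measurable f) (hg : Measurable g) : MeasurableSet {x | 0 ≤ f x ∧ f x ≤ g x} :=
  (measurableSet_le measurable_const hf).inter (measurableSet_le hf hg)

theorem measurable_setLIntegral_Icc {φ : ℝ × ℝ → ℝ≥0∞} (hφ : Measurable φ) :
    Measurable fun t : ℝ => ∫⁻ s in Icc (0 : ℝ) t, φ (t, s) := by
  simp_rw [setLIntegral_Icc_eq_indicator]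
  exact (Measurable.ite (measurableSet_triangle measurable_snd measurable_fst) hφ
    measurable_const).lintegral_prod_right'

theorem ENNReal.tsum_iSup_of_monotone {α : Type*} {x : ℕ → α → ℝ≥0∞} (hx : Monotone x) :
    ∑' k, ⨆ m, x m k = ⨆ m, ∑' k, x m k := by
  -- The sum is an integral against counting measure, so monotone convergence applies.
  let : MeasurableSpace α := ⊤
  simp_rw [← lintegral_count]
  exact lintegral_iSup (fun m => measurable_from_top) hx

/-- Both sides integrate over the triangle $s,u\ge 0$, $s+u\le t$; this is Tonelli. -/
theorem setLIntegral_Icc_swap (t : ℝ) {φ : ℝ → ℝ → ℝ≥0∞} (hφ : Measurable (Function.uncurry φ)) :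
    ∫⁻ s in Icc (0 : ℝ) t, ∫⁻ u in Icc (0 : ℝ) (t - s), φ s u =
      ∫⁻ u in Icc (0 : ℝ) t, ∫⁻ s in Icc (0 : ℝ) (t - u), φ s u := by
  have key : ∀ ψ : ℝ → ℝ → ℝ≥0∞,
      ∫⁻ s in Icc (0 : ℝ) t, ∫⁻ u in Icc (0 : ℝ) (t - s), ψ s u =
        ∫⁻ s, ∫⁻ u, (if 0 ≤ s ∧ 0 ≤ u ∧ s + u ≤ t then ψ s u else 0) := by
    intro ψ
    rw [setLIntegral_Icc_eq_indicator]
    refine lintegral_congr fun s => ?_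
    rw [setLIntegral_Icc_eq_indicator]
    split_ifs with h
    · refine lintegral_congr fun u => ?_
      congr 1
      apply propext
      constructor
      · rintro ⟨h1, h2⟩; exact ⟨h.1, h1, by linarith⟩
      · rintro ⟨_, h1, h2⟩; exact ⟨h1, by linarith⟩
    · rw [eq_comm, lintegral_eq_zero_of_ae_eq_zero]
      refine Eventually.of_forall fun u => ?_
      exact if_neg fun ⟨h0, h1, h2⟩ => h ⟨h0, by linarith⟩
  rw [key, key fun u s => φ s u, lintegral_lintegral_swap]
  · refine lintegral_congr fun u => lintegral_congr fun s => ?_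
    congr 1
    apply propext
    rw [add_comm s u]
    tauto
  · refine (Measurable.ite ?_ hφ measurable_const).aemeasurable
    exact (measurableSet_le measurable_const measurable_fst).inter
      ((measurableSet_le measurable_const measurable_snd).inter
        (measurableSet_le (measurable_fst.add measurable_snd) measurable_const))

variable {Q : Matrix S S ℝ} {f g : ℝ → S → S → ℝ≥0∞}

theorem measurable_ofReal_exp_mul (q : ℝ) :
    Measurable fun s : ℝ => ENNReal.ofReal (Real.exp (q * s)) := by fun_prop

variable [Countable S]

theorem measurable_backwardStep (hf : ∀ i j, Measurable fun t => f t i j) (i j : S) :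
    Measurable fun t => backwardStep Q f t i j := by
  refine measurable_setLIntegral_Icc (φ := fun p => ENNReal.ofReal (Real.exp (Q i i * p.2)) *
    ∑' k : {k : S // k ≠ i}, ENNReal.ofReal (Q i k) * f (p.1 - p.2) k j) ?_
  refine ((measurable_ofReal_exp_mul _).comp measurable_snd).mul (Measurable.tsum fun k => ?_)
  exact ((hf k j).comp (measurable_fst.sub measurable_snd)).const_mul _

theorem measurable_forwardStep (hf : ∀ i j, Measurable fun t => f t i j) (i j : S) :
    Measurable fun t => forwardStep Q f t i j := by
  refine measurable_setLIntegral_Icc (φ := fun p => ENNReal.ofReal (Real.exp (Q j j * p.2)) *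
    ∑' k : {k : S // k ≠ j}, f (p.1 - p.2) i k * ENNReal.ofReal (Q k j)) ?_
  refine ((measurable_ofReal_exp_mul _).comp measurable_snd).mul (Measurable.tsum fun k => ?_)
  exact ((hf i k).comp (measurable_fst.sub measurable_snd)).mul_const _

theorem backwardStep_eq_tsum (hf : ∀ i j, Measurable fun t => f t i j) (t : ℝ) (i j : S) :
    backwardStep Q f t i j = ∑' k : {k : S // k ≠ i}, ∫⁻ s in Icc (0 : ℝ) t,
      ENNReal.ofReal (Real.exp (Q i i * s)) * (ENNReal.ofReal (Q i k) * f (t - s) k j) := by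
  simp_rw [backwardStep, ← ENNReal.tsum_mul_left]
  exact lintegral_tsum fun k => ((measurable_ofReal_exp_mul _).mul
    (((hf k j).comp (measurable_const.sub measurable_id)).const_mul _)).aemeasurable

theorem forwardStep_eq_tsum (hf : ∀ i j, Measurable fun t => f t i j) (t : ℝ) (i j : S) :
    forwardStep Q f t i j = ∑' k : {k : S // k ≠ j}, ∫⁻ s in Icc (0 : ℝ) t,
      ENNReal.ofReal (Real.exp (Q j j * s)) * (f (t - s) i k * ENNReal.ofReal (Q k j)) := by
  simp_rw [forwardStep, ← ENNReal.tsum_mul_left]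
  exact lintegral_tsum fun k => ((measurable_ofReal_exp_mul _).mul
    (((hf i k).comp (measurable_const.sub measurable_id)).mul_const _)).aemeasurable

theorem backwardStep_add (hf : ∀ i j, Measurable fun t => f t i j) :
    backwardStep Q (f + g) = backwardStep Q f + backwardStep Q g := by
  ext t i j
  simp only [backwardStep, Pi.add_apply, mul_add, ENNReal.tsum_add]
  refine lintegral_add_left ((measurable_ofReal_exp_mul _).mul (Measurable.tsum fun k => ?_)) _
  exact ((hf k j).comp (measurable_const.sub measurable_id)).const_mul _

theorem forwardStep_add (hf : ∀ i j, Measurable fun t => f t i j) :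
    forwardStep Q (f + g) = forwardStep Q f + forwardStep Q g := by
  ext t i j
  simp only [forwardStep, Pi.add_apply, mul_add, add_mul, ENNReal.tsum_add]
  refine lintegral_add_left ((measurable_ofReal_exp_mul _).mul (Measurable.tsum fun k => ?_)) _
  exact ((hf i k).comp (measurable_const.sub measurable_id)).mul_const _

theorem setLIntegral_Icc_reflect (t : ℝ) (φ : ℝ → ℝ≥0∞) :
    ∫⁻ s in Icc (0 : ℝ) t, φ (t - s) = ∫⁻ s in Icc (0 : ℝ) t, φ s := by
  rw [setLIntegral_Icc_eq_indicator, setLIntegral_Icc_eq_indicator,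
    ← lintegral_sub_left_eq_self _ t]
  refine lintegral_congr fun s => ?_
  have h : (0 ≤ t - s ∧ t - s ≤ t) ↔ (0 ≤ s ∧ s ≤ t) := by
    constructor <;> rintro ⟨h1, h2⟩ <;> constructor <;> linarith
  simp only [h, sub_sub_cancel]

/-- Either order prescribes a first jump from $i$, a last jump into $j$, and $f$ run for the time in
between; only the order of summation and integration differs. -/
theorem backwardStep_forwardStep (hf : ∀ i j, Measurable fun t => f t i j) :
    backwardStep Q (forwardStep Q f) = forwardStep Q (backwardStep Q f) := by
  ext t i j
  rw [backwardStep_eq_tsum (measurable_forwardStep hf),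
    forwardStep_eq_tsum (measurable_backwardStep hf)]
  have hsub : ∀ t : ℝ, Measurable fun s : ℝ => t - s := fun t =>
    measurable_const.sub measurable_id
  have hL : ∀ (k : {k : S // k ≠ i}), ∫⁻ s in Icc (0 : ℝ) t, ENNReal.ofReal (Real.exp (Q i i * s)) *
        (ENNReal.ofReal (Q i k) * forwardStep Q f (t - s) k j) =
      ∑' l : {l : S // l ≠ j}, ∫⁻ s in Icc (0 : ℝ) t, ∫⁻ u in Icc (0 : ℝ) (t - s),
        ENNReal.ofReal (Real.exp (Q i i * s)) * (ENNReal.ofReal (Q i k) *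
          (ENNReal.ofReal (Real.exp (Q j j * u)) *
            (f (t - s - u) k l * ENNReal.ofReal (Q l j)))) := by
    intro k
    simp_rw [forwardStep_eq_tsum hf, ← ENNReal.tsum_mul_left]
    rw [lintegral_tsum]
    · refine tsum_congr fun l => lintegral_congr fun s => ?_
      have hm : Measurable fun u => ENNReal.ofReal (Real.exp (Q j j * u)) *
            (f (t - s - u) k l * ENNReal.ofReal (Q l j)) :=
        (measurable_ofReal_exp_mul _).mul (((hf k l).comp (hsub _)).mul_const _)
      rw [lintegral_const_mul _ (hm.const_mul _), lintegral_const_mul _ hm]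
    · intro l
      refine ((measurable_ofReal_exp_mul _).mul (Measurable.const_mul ?_ _)).aemeasurable
      refine (measurable_setLIntegral_Icc (φ := fun p => ENNReal.ofReal (Real.exp (Q j j * p.2)) *
          (f (p.1 - p.2) k l * ENNReal.ofReal (Q l j))) ?_).comp (hsub t)
      exact ((measurable_ofReal_exp_mul _).comp measurable_snd).mul
        (((hf k l).comp (measurable_fst.sub measurable_snd)).mul_const _)
  have hR : ∀ (l : {l : S // l ≠ j}), ∫⁻ u in Icc (0 : ℝ) t, ENNReal.ofReal (Real.exp (Q j j * u)) *
        (backwardStep Q f (t - u) i l * ENNReal.ofReal (Q l j)) =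
      ∑' k : {k : S // k ≠ i}, ∫⁻ u in Icc (0 : ℝ) t, ∫⁻ s in Icc (0 : ℝ) (t - u),
        ENNReal.ofReal (Real.exp (Q j j * u)) * ((ENNReal.ofReal (Real.exp (Q i i * s)) *
          (ENNReal.ofReal (Q i k) * f (t - u - s) k l)) * ENNReal.ofReal (Q l j)) := by
    intro l
    simp_rw [backwardStep_eq_tsum hf, ← ENNReal.tsum_mul_right, ← ENNReal.tsum_mul_left]
    rw [lintegral_tsum]
    · refine tsum_congr fun k => lintegral_congr fun u => ?_
      have hm : Measurable fun s => ENNReal.ofReal (Real.exp (Q i i * s)) *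
            (ENNReal.ofReal (Q i k) * f (t - u - s) k l) :=
        (measurable_ofReal_exp_mul _).mul (((hf k l).comp (hsub _)).const_mul _)
      rw [lintegral_const_mul _ (hm.mul_const _), lintegral_mul_const _ hm]
    · intro k
      refine ((measurable_ofReal_exp_mul _).mul (Measurable.mul_const ?_ _)).aemeasurable
      refine (measurable_setLIntegral_Icc (φ := fun p => ENNReal.ofReal (Real.exp (Q i i * p.2)) *
          (ENNReal.ofReal (Q i k) * f (p.1 - p.2) k l)) ?_).comp (hsub t)
      exact ((measurable_ofReal_exp_mul _).comp measurable_snd).mul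
        (((hf k l).comp (measurable_fst.sub measurable_snd)).const_mul _)
  simp_rw [hL, hR]
  rw [ENNReal.tsum_comm]
  refine tsum_congr fun l => tsum_congr fun k => ?_
  rw [setLIntegral_Icc_swap]
  · refine lintegral_congr fun u => lintegral_congr fun s => ?_
    rw [sub_right_comm]
    ring
  · refine ((measurable_ofReal_exp_mul _).comp measurable_fst).mul (Measurable.const_mul
      (((measurable_ofReal_exp_mul _).comp measurable_snd).mul (Measurable.mul_const ?_ _)) _)
    exact (hf k l).comp ((measurable_const.sub measurable_fst).sub measurable_snd)

variable [DecidableEq S]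

theorem measurable_diagExp {S : Type*} [DecidableEq S] {Q : Matrix S S ℝ} (i j : S) : Measurable fun t => diagExp Q t i j := by
  unfold diagExp
  split_ifs
  · exact measurable_ofReal_exp_mul _
  · exact measurable_const

theorem fellerIter_mono {S : Type*} [DecidableEq S] {Q : Matrix S S ℝ} : Monotone (fellerIter Q) := by
  refine monotone_nat_of_le_succ fun m => ?_
  induction m with
  | zero => exact fun t i j => le_self_add
  | succ m ih =>
    intro t i j
    rw [fellerIter_succ, fellerIter_succ Q (m + 1)]
    refine add_le_add le_rfl (lintegral_mono fun s => ?_)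
    gcongr
    exact ih _ _ _

theorem measurable_fellerIter (m : ℕ) (i j : S) : Measurable fun t => fellerIter Q m t i j := by
  induction m generalizing i j with
  | zero => exact measurable_diagExp i j
  | succ m ih => exact (measurable_diagExp i j).add (measurable_backwardStep ih i j)

/-- A path with exactly one jump has the same first and last jump; $s\mapsto t-s$ exchanges the
holding times before and after it. -/
theorem backwardStep_diagExp {S : Type*} [DecidableEq S] {Q : Matrix S S ℝ} :
    backwardStep Q (diagExp Q) = forwardStep Q (diagExp Q) := by
  ext t i j
  unfold backwardStep forwardStep
  rw [← setLIntegral_Icc_reflect t]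
  refine lintegral_congr fun s => ?_
  by_cases hij : i = j
  · subst hij
    have h1 : ∀ k : {k : S // k ≠ i}, diagExp Q (t - (t - s)) k i = 0 := fun k => if_neg k.2
    have h2 : ∀ k : {k : S // k ≠ i}, diagExp Q (t - s) i k = 0 := fun k => if_neg k.2.symm
    simp only [h1, h2, mul_zero, zero_mul, tsum_zero]
  · rw [tsum_eq_single (⟨j, fun h => hij h.symm⟩ : {k : S // k ≠ i}),
      tsum_eq_single (⟨i, hij⟩ : {k : S // k ≠ j})]
    · simp only [diagExp, if_true, sub_sub_cancel]
      ring
    · intro k hk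
      rw [diagExp, if_neg, zero_mul]
      exact fun h => hk (Subtype.ext h.symm)
    · intro k hk
      rw [diagExp, if_neg, mul_zero]
      exact fun h => hk (Subtype.ext h)

/-- The Feller iterates also satisfy the recursion obtained by decomposing at the last jump. -/
theorem fellerIter_succ_eq_forwardStep (m : ℕ) :
    fellerIter Q (m + 1) = diagExp Q + forwardStep Q (fellerIter Q m) := by
  induction m with
  | zero => rw [fellerIter_succ, fellerIter_zero, backwardStep_diagExp]
  | succ m ih =>
    -- With $E$ the diagonal part and $B$, $F$ the two steps: $E+B(E+Ff_m)=E+FE+FBf_m=E+F(E+Bf_m)$.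
    rw [fellerIter_succ Q (m + 1), ih, backwardStep_add measurable_diagExp, backwardStep_diagExp,
      backwardStep_forwardStep (measurable_fellerIter m), ← forwardStep_add measurable_diagExp,
      ← fellerIter_succ, ih]

/-- Monotone convergence in the last-jump recursion gives the forward integral equation. -/
theorem iSup_fellerIter_eq_forwardStep (t : ℝ) (i j : S) :
    ⨆ m, fellerIter Q m t i j =
      diagExp Q t i j + forwardStep Q (fun t i j => ⨆ m, fellerIter Q m t i j) t i j := by
  have hmono : ∀ t i j, Monotone fun m => fellerIter Q m t i j :=
    fun t i j a b h => fellerIter_mono h t i j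
  rw [← (hmono t i j).iSup_nat_add 1]
  simp_rw [fellerIter_succ_eq_forwardStep, Pi.add_apply]
  rw [← ENNReal.add_iSup]
  congr 1
  simp_rw [forwardStep]
  rw [← lintegral_iSup]
  · refine lintegral_congr fun s => ?_
    rw [← ENNReal.mul_iSup]
    congr 1
    rw [← ENNReal.tsum_iSup_of_monotone]
    · exact tsum_congr fun k => (ENNReal.iSup_mul _ _).symm
    intro a b h k
    dsimp only
    gcongr
    exact hmono _ _ _ h
  · intro m
    refine (measurable_ofReal_exp_mul _).mul (Measurable.tsum fun k => ?_)
    exact ((measurable_fellerIter m i k).comp (measurable_const.sub measurable_id)).mul_const _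
  · intro a b h s
    dsimp only
    gcongr
    exact hmono _ _ _ h

end FellerIteration

/-! ### The minimal process is substochastic and solves the forward equation. -/

section ForwardEquation

variable {S : Type*} {Q : Matrix S S ℝ}

theorem sum_offDiag_le (hoff : ∀ i j, i ≠ j → 0 ≤ Q i j) (hrow : ∀ i, HasSum (Q i) 0) {i : S}
    {T : Finset S} (hT : i ∉ T) : ∑ j ∈ T, Q i j ≤ -Q i i := by
  classical
  have h := sum_le_hasSum (insert i T)
    (fun j hj => hoff i j fun e => hj (e ▸ Finset.mem_insert_self i T)) (hrow i)
  rw [Finset.sum_insert hT] at h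
  linarith

theorem diag_nonpos (hoff : ∀ i j, i ≠ j → 0 ≤ Q i j) (hrow : ∀ i, HasSum (Q i) 0) (i : S) :
    Q i i ≤ 0 := by
  have h := sum_offDiag_le hoff hrow (Finset.notMem_empty i)
  rw [Finset.sum_empty] at h
  linarith

theorem tsum_ofReal_offDiag_le (hoff : ∀ i j, i ≠ j → 0 ≤ Q i j) (hrow : ∀ i, HasSum (Q i) 0)
    (i : S) : ∑' k : {k : S // k ≠ i}, ENNReal.ofReal (Q i k) ≤ ENNReal.ofReal (-Q i i) := by
  rw [ENNReal.tsum_eq_iSup_sum]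
  refine iSup_le fun T => ?_
  have hnn : ∀ k ∈ T, 0 ≤ Q i k := fun k _ => hoff i k k.2.symm
  rw [← ENNReal.ofReal_sum_of_nonneg hnn]
  refine ENNReal.ofReal_le_ofReal ?_
  have h := sum_offDiag_le hoff hrow (i := i) (T := T.map (Function.Embedding.subtype _)) (by simp)
  rwa [Finset.sum_map] at h

theorem setLIntegral_exp_mul (q : ℝ) (hq : q ≤ 0) {t : ℝ} (ht : 0 ≤ t) :
    ∫⁻ s in Icc (0 : ℝ) t, ENNReal.ofReal (Real.exp (q * s)) * ENNReal.ofReal (-q) =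
      ENNReal.ofReal (1 - Real.exp (q * t)) := by
  have hc : Continuous fun s => Real.exp (q * s) * -q := by fun_prop
  simp_rw [← ENNReal.ofReal_mul (Real.exp_nonneg _)]
  rw [← ofReal_integral_eq_lintegral_ofReal (hc.integrableOn_Icc)]
  · rw [integral_Icc_eq_integral_Ioc, ← intervalIntegral.integral_of_le ht,
      intervalIntegral.integral_eq_sub_of_hasDerivAt (f := fun s => -Real.exp (q * s))]
    · simp [sub_eq_add_neg, add_comm]
    · intro s _
      refine ((hasDerivAt_id s).const_mul q).exp.neg.congr_deriv ?_
      simp only [id, mul_one, mul_neg]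
    · exact hc.intervalIntegrable _ _
  · exact Eventually.of_forall fun s => mul_nonneg (Real.exp_nonneg _) (by simpa using hq)

variable [DecidableEq S]

theorem tsum_diagExp (t : ℝ) (i : S) :
    ∑' j, diagExp Q t i j = ENNReal.ofReal (Real.exp (Q i i * t)) := by
  rw [tsum_eq_single i]
  · simp [diagExp]
  · intro j hj
    simp [diagExp, hj.symm]

theorem monotone_fellerIter_apply (t : ℝ) (i j : S) : Monotone fun m => fellerIter Q m t i j :=
  fun _ _ h => fellerIter_mono h t i j

variable [Countable S]

/-- Condition on the first jump: no jump has probability $e^{q_{ii}t}$, and the rest contributes at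
most $1-e^{q_{ii}t}$ by induction. -/
theorem tsum_fellerIter_le_one (hoff : ∀ i j, i ≠ j → 0 ≤ Q i j) (hrow : ∀ i, HasSum (Q i) 0)
    (m : ℕ) {t : ℝ} (ht : 0 ≤ t) (i : S) : ∑' j, fellerIter Q m t i j ≤ 1 := by
  induction m generalizing t i with
  | zero =>
    rw [fellerIter_zero, tsum_diagExp, ENNReal.ofReal_le_one, Real.exp_le_one_iff]
    exact mul_nonpos_of_nonpos_of_nonneg (diag_nonpos hoff hrow i) ht
  | succ m ih =>
    have hq := diag_nonpos hoff hrow i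
    have hstep : ∑' j, backwardStep Q (fellerIter Q m) t i j ≤
        ENNReal.ofReal (1 - Real.exp (Q i i * t)) := by
      rw [← setLIntegral_exp_mul _ hq ht]
      simp_rw [backwardStep]
      rw [← lintegral_tsum]
      · refine setLIntegral_mono' measurableSet_Icc fun s hs => ?_
        rw [ENNReal.tsum_mul_left, ENNReal.tsum_comm]
        gcongr
        refine le_trans ?_ (tsum_ofReal_offDiag_le hoff hrow i)
        refine ENNReal.tsum_le_tsum fun k => ?_
        rw [ENNReal.tsum_mul_left]
        exact mul_le_of_le_one_right' (ih (by linarith [hs.2]) k)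
      · intro j
        refine ((measurable_ofReal_exp_mul _).mul (Measurable.tsum fun k => ?_)).aemeasurable
        exact ((measurable_fellerIter m (k : S) j).comp
          (measurable_const.sub measurable_id)).const_mul _
    simp_rw [fellerIter_succ, Pi.add_apply]
    rw [ENNReal.tsum_add, tsum_diagExp]
    refine (add_le_add le_rfl hstep).trans ?_
    rw [← ENNReal.ofReal_add (Real.exp_nonneg _), add_sub_cancel, ENNReal.ofReal_one]
    rw [sub_nonneg, Real.exp_le_one_iff]
    exact mul_nonpos_of_nonpos_of_nonneg hq ht

theorem tsum_iSup_fellerIter_le_one (hoff : ∀ i j, i ≠ j → 0 ≤ Q i j)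
    (hrow : ∀ i, HasSum (Q i) 0) {t : ℝ} (ht : 0 ≤ t) (i : S) :
    ∑' j, ⨆ m, fellerIter Q m t i j ≤ 1 := by
  rw [ENNReal.tsum_iSup_of_monotone fun a b h j => monotone_fellerIter_apply t i j h]
  exact iSup_le fun m => tsum_fellerIter_le_one hoff hrow m ht i

theorem iSup_fellerIter_le_one (hoff : ∀ i j, i ≠ j → 0 ≤ Q i j)
    (hrow : ∀ i, HasSum (Q i) 0) {t : ℝ} (ht : 0 ≤ t) (i j : S) :
    ⨆ m, fellerIter Q m t i j ≤ 1 :=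
  (ENNReal.le_tsum j).trans (tsum_iSup_fellerIter_le_one hoff hrow ht i)

theorem fellerMinimal_nonneg {S : Type*} [DecidableEq S] {Q : Matrix S S ℝ} (t : ℝ≥0) (i j : S) : 0 ≤ fellerMinimal Q t i j :=
  ENNReal.toReal_nonneg

theorem ofReal_fellerMinimal (hoff : ∀ i j, i ≠ j → 0 ≤ Q i j)
    (hrow : ∀ i, HasSum (Q i) 0) (t : ℝ≥0) (i j : S) :
    ENNReal.ofReal (fellerMinimal Q t i j) = ⨆ m, fellerIter Q m t i j :=
  ENNReal.ofReal_toReal ((iSup_fellerIter_le_one hoff hrow t.2 i j).trans_lt ENNReal.one_lt_top).ne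

theorem tsum_ofReal_fellerMinimal_le_one (hoff : ∀ i j, i ≠ j → 0 ≤ Q i j)
    (hrow : ∀ i, HasSum (Q i) 0) (t : ℝ≥0) (i : S) :
    ∑' j, ENNReal.ofReal (fellerMinimal Q t i j) ≤ 1 := by
  simp_rw [ofReal_fellerMinimal hoff hrow]
  exact tsum_iSup_fellerIter_le_one hoff hrow t.2 i

theorem sum_fellerMinimal_le_one (hoff : ∀ i j, i ≠ j → 0 ≤ Q i j)
    (hrow : ∀ i, HasSum (Q i) 0) (t : ℝ≥0) (i : S) (T : Finset S) :
    ∑ j ∈ T, fellerMinimal Q t i j ≤ 1 := by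
  rw [← ENNReal.ofReal_le_one, ENNReal.ofReal_sum_of_nonneg fun j _ => fellerMinimal_nonneg t i j]
  exact (ENNReal.sum_le_tsum T).trans (tsum_ofReal_fellerMinimal_le_one hoff hrow t i)

theorem fellerMinimal_le_one (hoff : ∀ i j, i ≠ j → 0 ≤ Q i j)
    (hrow : ∀ i, HasSum (Q i) 0) (t : ℝ≥0) (i j : S) : fellerMinimal Q t i j ≤ 1 := by
  simpa using sum_fellerMinimal_le_one hoff hrow t i {j}

theorem summable_fellerMinimal (hoff : ∀ i j, i ≠ j → 0 ≤ Q i j)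
    (hrow : ∀ i, HasSum (Q i) 0) (t : ℝ≥0) (i : S) : Summable fun j => fellerMinimal Q t i j :=
  summable_of_sum_le (fellerMinimal_nonneg t i) (sum_fellerMinimal_le_one hoff hrow t i)

theorem measurable_fellerMinimal_toNNReal (i j : S) :
    Measurable fun s : ℝ => fellerMinimal Q s.toNNReal i j :=
  ((Measurable.iSup fun m => measurable_fellerIter m i j).comp
    (measurable_coe_nnreal_real.comp measurable_real_toNNReal)).ennreal_toReal

/-- Pulling $e^{q_{jj}t}$ out of the integral leaves $t$ only in a smooth factor and the upper
limit. Measurability and boundedness of the integrand then give continuity, and continuity gives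
differentiability. -/
theorem fellerMinimal_eq_integral (hoff : ∀ i j, i ≠ j → 0 ≤ Q i j) (hrow : ∀ i, HasSum (Q i) 0)
    {j : S} {C : Finset S} (hC : ∀ k, k ∉ C → Q k j = 0) (i : S) {t : ℝ} (ht : 0 ≤ t) :
    fellerMinimal Q t.toNNReal i j = Real.exp (Q j j * t) * ((1 : Matrix S S ℝ) i j +
      ∫ s in (0 : ℝ)..t, Real.exp (-(Q j j * s)) *
        ∑ k ∈ C.erase j, fellerMinimal Q s.toNNReal i k * Q k j) := by
  have hcore : forwardStep Q (fun t i j => ⨆ m, fellerIter Q m t i j) t i j =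
      ∫⁻ s in Icc (0 : ℝ) t, ENNReal.ofReal (Real.exp (Q j j * (t - s)) *
        ∑ k ∈ C.erase j, fellerMinimal Q s.toNNReal i k * Q k j) := by
    rw [forwardStep, ← setLIntegral_Icc_reflect]
    refine setLIntegral_congr_fun measurableSet_Icc fun s hs => ?_
    have hnn : ∀ k ∈ C.erase j, 0 ≤ fellerMinimal Q s.toNNReal i k * Q k j := fun k hk =>
      mul_nonneg (fellerMinimal_nonneg _ _ _) (hoff _ _ (Finset.ne_of_mem_erase hk))
    rw [ENNReal.ofReal_mul (Real.exp_nonneg _), ENNReal.ofReal_sum_of_nonneg hnn]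
    congr 1
    simp_rw [sub_sub_cancel, ENNReal.ofReal_mul (fellerMinimal_nonneg _ _ _),
      ofReal_fellerMinimal hoff hrow, Real.coe_toNNReal s hs.1]
    refine (tsum_subtype {k | k ≠ j} fun k =>
      (⨆ m, fellerIter Q m s i k) * ENNReal.ofReal (Q k j)).trans ?_
    rw [tsum_eq_sum (s := C.erase j)]
    · exact Finset.sum_congr rfl fun k hk =>
        indicator_of_mem (show k ∈ {k | k ≠ j} from Finset.ne_of_mem_erase hk) _
    · intro k hk
      by_cases hkj : k = j
      · exact indicator_of_notMem (by simpa using hkj) _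
      · refine (indicator_of_mem (show k ∈ {k | k ≠ j} from hkj) _).trans ?_
        rw [hC k fun h => hk (Finset.mem_erase.2 ⟨hkj, h⟩), ENNReal.ofReal_zero, mul_zero]
  have hmain := iSup_fellerIter_eq_forwardStep (Q := Q) t i j
  have htop : ⨆ m, fellerIter Q m t i j ≠ ⊤ :=
    ((iSup_fellerIter_le_one hoff hrow ht i j).trans_lt ENNReal.one_lt_top).ne
  have htop2 : forwardStep Q (fun t i j => ⨆ m, fellerIter Q m t i j) t i j ≠ ⊤ := by
    rw [hmain] at htop
    exact fun h => htop (by rw [h, add_top])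
  have htop1 : diagExp Q t i j ≠ ⊤ := by
    rw [hmain] at htop
    exact fun h => htop (by rw [h, top_add])
  have hdiag : (diagExp Q t i j).toReal = Real.exp (Q j j * t) * (1 : Matrix S S ℝ) i j := by
    by_cases hij : i = j
    · subst hij
      simp [diagExp, ENNReal.toReal_ofReal (Real.exp_nonneg _)]
    · simp [diagExp, hij]
  rw [fellerMinimal, Real.coe_toNNReal t ht, hmain, ENNReal.toReal_add htop1 htop2, hdiag, hcore,
    ← integral_eq_lintegral_of_nonneg_ae, integral_Icc_eq_integral_Ioc,
    ← intervalIntegral.integral_of_le ht, mul_add, ← intervalIntegral.integral_const_mul]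
  · congr 1
    refine intervalIntegral.integral_congr fun s _ => ?_
    rw [← mul_assoc, ← Real.exp_add]
    congr 2
    ring
  · exact Eventually.of_forall fun s => mul_nonneg (Real.exp_nonneg _) (Finset.sum_nonneg
      fun k hk => mul_nonneg (fellerMinimal_nonneg _ _ _) (hoff _ _ (Finset.ne_of_mem_erase hk)))
  · refine Measurable.aestronglyMeasurable (Measurable.mul (by fun_prop) ?_)
    exact Finset.measurable_sum _ fun k _ => (measurable_fellerMinimal_toNNReal i k).mul_const _

theorem continuous_fellerMinimal_toNNReal (hoff : ∀ i j, i ≠ j → 0 ≤ Q i j)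
    (hrow : ∀ i, HasSum (Q i) 0) (hcol : ∀ j, {k | Q k j ≠ 0}.Finite) (i j : S) :
    Continuous fun s : ℝ => fellerMinimal Q s.toNNReal i j := by
  have hC : ∀ k, k ∉ (hcol j).toFinset → Q k j = 0 := fun k hk => by simpa using hk
  set C := (hcol j).toFinset
  -- `Real.toNNReal` sees only $\max(s,0)$, so the formula for $t\ge 0$ extends to the whole line.
  have heq : (fun s : ℝ => fellerMinimal Q s.toNNReal i j) = fun s : ℝ =>
      Real.exp (Q j j * max s 0) * ((1 : Matrix S S ℝ) i j + ∫ u in (0 : ℝ)..(max s 0),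
        Real.exp (-(Q j j * u)) * ∑ k ∈ C.erase j, fellerMinimal Q u.toNNReal i k * Q k j) := by
    funext s
    rw [← fellerMinimal_eq_integral hoff hrow hC i (le_max_right s 0)]
    congr 1
    ext
    simp only [Real.coe_toNNReal', max_assoc, max_self]
  have hint : ∀ a b : ℝ, IntervalIntegrable (fun u => Real.exp (-(Q j j * u)) *
      ∑ k ∈ C.erase j, fellerMinimal Q u.toNNReal i k * Q k j) volume a b := by
    intro a b
    have hsum : IntervalIntegrable
        (fun u => ∑ k ∈ C.erase j, fellerMinimal Q u.toNNReal i k * Q k j) volume a b := by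
      have hmeas : Measurable fun u : ℝ =>
          ∑ k ∈ C.erase j, fellerMinimal Q u.toNNReal i k * Q k j :=
        Finset.measurable_sum _ fun k _ => (measurable_fellerMinimal_toNNReal i k).mul_const _
      refine (intervalIntegrable_const (c := ∑ k ∈ C.erase j, Q k j)).mono_fun
        hmeas.aestronglyMeasurable ?_
      refine Eventually.of_forall fun u => ?_
      have hk0 : ∀ k ∈ C.erase j, 0 ≤ Q k j := fun k hk => hoff _ _ (Finset.ne_of_mem_erase hk)
      dsimp only
      rw [Real.norm_of_nonneg (Finset.sum_nonneg fun k hk =>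
        mul_nonneg (fellerMinimal_nonneg _ _ _) (hk0 k hk)),
        Real.norm_of_nonneg (Finset.sum_nonneg hk0)]
      exact Finset.sum_le_sum fun k hk =>
        mul_le_of_le_one_left (hk0 k hk) (fellerMinimal_le_one hoff hrow _ _ _)
    exact hsum.continuousOn_mul (by fun_prop)
  rw [heq]
  have hmax : Continuous fun s : ℝ => max s 0 := continuous_id.max continuous_const
  refine Continuous.mul (by fun_prop) (continuous_const.add ?_)
  exact (intervalIntegral.continuous_primitive hint 0).comp hmax

theorem satisfiesForwardEquation_fellerMinimal (hoff : ∀ i j, i ≠ j → 0 ≤ Q i j)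
    (hrow : ∀ i, HasSum (Q i) 0) (hcol : ∀ j, {k | Q k j ≠ 0}.Finite) :
    SatisfiesForwardEquation Q (fellerMinimal Q) := by
  intro t i j
  have hC : ∀ k, k ∉ (hcol j).toFinset → Q k j = 0 := fun k hk => by simpa using hk
  set C := (hcol j).toFinset
  have hz : ∀ k ∉ C, fellerMinimal Q t i k * Q k j = 0 := fun k hk => by rw [hC k hk, mul_zero]
  refine ⟨summable_of_ne_finset_zero hz, ?_⟩
  rw [tsum_eq_sum hz]
  have hG : Continuous fun u : ℝ => Real.exp (-(Q j j * u)) *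
      ∑ k ∈ C.erase j, fellerMinimal Q u.toNNReal i k * Q k j := by
    refine Continuous.mul (by fun_prop) (continuous_finsetSum _ fun k _ => ?_)
    exact (continuous_fellerMinimal_toNNReal hoff hrow hcol i k).mul_const _
  have hint := (hG.integral_hasStrictDerivAt 0 (t : ℝ)).hasDerivAt.const_add
    ((1 : Matrix S S ℝ) i j)
  have hd := (((hasDerivAt_id (t : ℝ)).const_mul (Q j j)).exp.mul hint).hasDerivWithinAt
    (s := Ici (0 : ℝ))
  refine (hd.congr (fun s hs => fellerMinimal_eq_integral hoff hrow hC i hs)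
    (fellerMinimal_eq_integral hoff hrow hC i t.2)).congr_deriv ?_
  have hval := fellerMinimal_eq_integral hoff hrow hC i t.2
  have hsplit : ∑ k ∈ C, fellerMinimal Q t i k * Q k j =
      fellerMinimal Q t i j * Q j j + ∑ k ∈ C.erase j, fellerMinimal Q t i k * Q k j := by
    by_cases hj : j ∈ C
    · exact (Finset.add_sum_erase C (fun k => fellerMinimal Q t i k * Q k j) hj).symm
    · rw [hC j hj, mul_zero, zero_add, Finset.erase_eq_of_notMem hj]
  change fellerMinimal Q (t : ℝ).toNNReal i j = _ at hval
  rw [Real.toNNReal_coe] at hval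
  have hexp : Real.exp (Q j j * t) * Real.exp (-(Q j j * t)) = 1 := by
    rw [← Real.exp_add, add_neg_cancel, Real.exp_zero]
  rw [hsplit, hval]
  simp only [Real.toNNReal_coe, id, mul_one]
  have hring : ∀ E E' q x r : ℝ, E * E' = 1 → E * q * x + E * (E' * r) = E * x * q + r :=
    fun E E' q x r h => by linear_combination r * h
  exact hring _ _ _ _ _ hexp

end ForwardEquation

/-! ### Uniqueness for the forward equation by truncated generating functions. -/

section Uniqueness

/-- The absolute value of a right-differentiable function is right-differentiable even at its zeros,
so $|D_j|$ needs no smoothing. -/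
theorem HasDerivWithinAt.abs_Ici {f : ℝ → ℝ} {d t : ℝ} (h : HasDerivWithinAt f d (Ici t) t) :
    HasDerivWithinAt (fun s => |f s|) (if f t = 0 then |d| else SignType.sign (f t) * d)
      (Ici t) t := by
  split_ifs with h0
  · rw [hasDerivWithinAt_iff_tendsto_slope, Ici_sdiff_left] at h ⊢
    refine h.abs.congr' ?_
    filter_upwards [self_mem_nhdsWithin] with s hs
    rw [slope_def_field, slope_def_field, abs_div, h0, abs_zero, sub_zero, sub_zero,
      abs_of_pos (sub_pos.2 hs)]
  · exact (hasDerivAt_abs h0).comp_hasDerivWithinAt t h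

/-- Conditions on a conservative `q`-matrix: jumps decrease the weight `w` by at most one,
and the total rate of decreasing jumps is at most linear in the weight. -/
structure IsLinearlySkipFree {S : Type*} (Q : Matrix S S ℝ) (w : S → ℕ) (c : ℝ) : Prop where
  offDiag_nonneg : ∀ i j, i ≠ j → 0 ≤ Q i j
  hasSum_row : ∀ i, HasSum (Q i) 0
  finite_level : ∀ N, {j | w j ≤ N}.Finite
  weight_le : ∀ i j, Q i j ≠ 0 → w i ≤ w j + 1
  rate_nonneg : 0 ≤ c
  sum_down_le : ∀ i (T : Finset S), (∀ j ∈ T, w j < w i) → ∑ j ∈ T, Q i j ≤ c * w i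

namespace IsLinearlySkipFree

variable {S : Type*} {Q : Matrix S S ℝ} {w : S → ℕ} {c : ℝ}

/-- The states of weight at most `N`. -/
def level (h : IsLinearlySkipFree Q w c) (N : ℕ) : Finset S := (h.finite_level N).toFinset

theorem mem_level (h : IsLinearlySkipFree Q w c) {N : ℕ} {j : S} : j ∈ h.level N ↔ w j ≤ N := by
  simp [level]

theorem eq_zero_of_notMem_level (h : IsLinearlySkipFree Q w c) {N : ℕ} {j k : S} (hj : w j ≤ N)
    (hk : k ∉ h.level (N + 1)) : Q k j = 0 := by
  by_contra hne
  exact hk (h.mem_level.2 ((h.weight_le k j hne).trans (by omega)))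

theorem finite_col (h : IsLinearlySkipFree Q w c) (j : S) : {k | Q k j ≠ 0}.Finite :=
  (h.finite_level (w j + 1)).subset fun k hk => h.weight_le k j hk

theorem tsum_mul_eq_sum (h : IsLinearlySkipFree Q w c) {N : ℕ} {j : S} (hj : w j ≤ N)
    (x : S → ℝ) : ∑' k, x k * Q k j = ∑ k ∈ h.level (N + 1), x k * Q k j :=
  tsum_eq_sum fun k hk => by rw [h.eq_zero_of_notMem_level hj hk, mul_zero]

/-- Down-jumps land exactly on weight $w(k)-1$, other jumps on weight at least $w(k)$, where
$\sigma^{w(j)}\le\sigma^{w(k)}$. As the row sums to zero, what remains is the down-rate times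
$\sigma^{w(k)-1}-\sigma^{w(k)}$. -/
theorem sum_mul_pow_le (h : IsLinearlySkipFree Q w c) {N : ℕ} {k : S} (hk : w k ≤ N) {σ : ℝ}
    (h0 : 0 ≤ σ) (h1 : σ ≤ 1) :
    ∑ j ∈ h.level N, Q k j * σ ^ w j ≤ c * w k * σ ^ (w k - 1) * (1 - σ) := by
  classical
  have hkm : k ∈ h.level N := h.mem_level.2 hk
  have hoff := h.offDiag_nonneg
  rw [← Finset.add_sum_erase _ _ hkm,
    ← Finset.sum_filter_add_sum_filter_not ((h.level N).erase k) fun j => w j < w k]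
  set A := ((h.level N).erase k).filter fun j => w j < w k
  set B := ((h.level N).erase k).filter fun j => ¬ w j < w k
  have hne : ∀ j ∈ (h.level N).erase k, 0 ≤ Q k j := fun j hj =>
    hoff k j (Finset.ne_of_mem_erase hj).symm
  have hA : ∑ j ∈ A, Q k j * σ ^ w j = (∑ j ∈ A, Q k j) * σ ^ (w k - 1) := by
    rw [Finset.sum_mul]
    refine Finset.sum_congr rfl fun j hj => ?_
    by_cases hq : Q k j = 0
    · simp [hq]
    · have := h.weight_le k j hq
      have := (Finset.mem_filter.1 hj).2
      rw [show w j = w k - 1 by omega]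
  have hB : ∑ j ∈ B, Q k j * σ ^ w j ≤ (∑ j ∈ B, Q k j) * σ ^ w k := by
    rw [Finset.sum_mul]
    refine Finset.sum_le_sum fun j hj => ?_
    exact mul_le_mul_of_nonneg_left
      (pow_le_pow_of_le_one h0 h1 (not_lt.1 (Finset.mem_filter.1 hj).2))
      (hne j (Finset.mem_filter.1 hj).1)
  have hAB : ∑ j ∈ A, Q k j + ∑ j ∈ B, Q k j ≤ -Q k k := by
    rw [Finset.sum_filter_add_sum_filter_not]
    exact sum_offDiag_le hoff h.hasSum_row (Finset.notMem_erase k _)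
  have hdown : ∑ j ∈ A, Q k j ≤ c * w k :=
    h.sum_down_le k A fun j hj => (Finset.mem_filter.1 hj).2
  have hApos : 0 ≤ ∑ j ∈ A, Q k j :=
    Finset.sum_nonneg fun j hj => hne j (Finset.mem_filter.1 hj).1
  have hpow : 0 ≤ σ ^ w k := pow_nonneg h0 _
  have hp' : 0 ≤ σ ^ (w k - 1) := pow_nonneg h0 _
  rw [hA]
  have e : (∑ j ∈ A, Q k j) * (σ ^ (w k - 1) - σ ^ w k) =
      (∑ j ∈ A, Q k j) * (σ ^ (w k - 1) * (1 - σ)) := by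
    -- At weight zero the truncated $w(k)-1$ equals $w(k)$, but then the down-rate is zero.
    rcases Nat.eq_zero_or_pos (w k) with hw | hw
    · have : ∑ j ∈ A, Q k j = 0 := le_antisymm (by simpa [hw] using hdown) hApos
      simp [this]
    · congr 1
      conv_lhs => rw [← Nat.sub_add_cancel hw, Nat.add_sub_cancel, pow_succ]
      ring
  have h2 : (∑ j ∈ A, Q k j) * (σ ^ (w k - 1) * (1 - σ)) ≤
      c * w k * (σ ^ (w k - 1) * (1 - σ)) :=
    mul_le_mul_of_nonneg_right hdown (mul_nonneg hp' (sub_nonneg.2 h1))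
  have h3 : (∑ j ∈ B, Q k j) * σ ^ w k ≤ (-Q k k - ∑ j ∈ A, Q k j) * σ ^ w k :=
    mul_le_mul_of_nonneg_right (by linarith) hpow
  linarith

theorem sum_mul_pow_le_of_eq (h : IsLinearlySkipFree Q w c) {N : ℕ} {k : S} (hk : w k = N + 1)
    {σ : ℝ} (h0 : 0 ≤ σ) : ∑ j ∈ h.level N, Q k j * σ ^ w j ≤ c * (N + 1) * σ ^ N := by
  have hlow : ∀ j ∈ h.level N, w j < w k := fun j hj => by
    have := h.mem_level.1 hj
    omega
  have heq : ∑ j ∈ h.level N, Q k j * σ ^ w j = (∑ j ∈ h.level N, Q k j) * σ ^ N := by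
    rw [Finset.sum_mul]
    refine Finset.sum_congr rfl fun j hj => ?_
    by_cases hq : Q k j = 0
    · simp [hq]
    · have := h.weight_le k j hq
      have := hlow j hj
      rw [show w j = N by omega]
  have hd := h.sum_down_le k _ hlow
  rw [hk] at hd
  push_cast at hd
  rw [heq]
  exact mul_le_mul_of_nonneg_right hd (pow_nonneg h0 _)

theorem level_subset_succ (h : IsLinearlySkipFree Q w c) (N : ℕ) :
    h.level N ⊆ h.level (N + 1) := fun _ hj =>
  h.mem_level.2 ((h.mem_level.1 hj).trans (Nat.le_succ N))

/-- Interior states give the transport term. Outside the truncation only weight $N+1$ can enter it,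
and its total mass is at most $M$. -/
theorem sum_sum_mul_pow_le (h : IsLinearlySkipFree Q w c) (N : ℕ) {x : S → ℝ} (hx : ∀ k, 0 ≤ x k)
    {M : ℝ} (hM : ∀ T : Finset S, ∑ k ∈ T, x k ≤ M) {σ : ℝ} (h0 : 0 ≤ σ) (h1 : σ ≤ 1) :
    ∑ j ∈ h.level N, (∑ k ∈ h.level (N + 1), x k * Q k j) * σ ^ w j ≤
      ∑ k ∈ h.level N, x k * (w k * σ ^ (w k - 1) * (c * (1 - σ))) + M * (c * (N + 1) * σ ^ N) := by
  classical
  have hswap : ∑ j ∈ h.level N, (∑ k ∈ h.level (N + 1), x k * Q k j) * σ ^ w j =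
      ∑ k ∈ h.level (N + 1), x k * ∑ j ∈ h.level N, Q k j * σ ^ w j := by
    simp_rw [Finset.sum_mul, Finset.mul_sum]
    rw [Finset.sum_comm]
    simp_rw [mul_assoc]
  rw [hswap, ← Finset.sum_sdiff (h.level_subset_succ N), add_comm]
  refine add_le_add (Finset.sum_le_sum fun k hk => ?_) ?_
  · refine mul_le_mul_of_nonneg_left ?_ (hx k)
    refine (h.sum_mul_pow_le (h.mem_level.1 hk) h0 h1).trans_eq ?_
    ring
  · refine (Finset.sum_le_sum fun k hk => ?_ :
      _ ≤ ∑ k ∈ h.level (N + 1) \ h.level N, x k * (c * (N + 1) * σ ^ N)).trans ?_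
    · obtain ⟨hk1, hk2⟩ := Finset.mem_sdiff.1 hk
      rw [h.mem_level] at hk1 hk2
      exact mul_le_mul_of_nonneg_left (h.sum_mul_pow_le_of_eq (by omega) h0) (hx k)
    · rw [← Finset.sum_mul]
      refine mul_le_mul_of_nonneg_right (hM _) ?_
      have := h.rate_nonneg
      positivity

/-- A Kato-type inequality: the sign of $x_j$ turns the diagonal term into $|x_j|q_{jj}$ exactly,
and off-diagonal terms only grow under absolute values because their rates are nonnegative. -/
theorem abs_deriv_le (h : IsLinearlySkipFree Q w c) (x : S → ℝ) (A : Finset S) (j : S) :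
    (if x j = 0 then |∑ k ∈ A, x k * Q k j| else
      (SignType.sign (x j) : ℝ) * ∑ k ∈ A, x k * Q k j) ≤ ∑ k ∈ A, |x k| * Q k j := by
  split_ifs with hj
  · refine (Finset.abs_sum_le_sum_abs _ _).trans (Finset.sum_le_sum fun k _ => ?_)
    by_cases hk : k = j
    · rw [hk, hj]
      simp
    · rw [abs_mul, abs_of_nonneg (h.offDiag_nonneg k j hk)]
  · rw [Finset.mul_sum]
    refine Finset.sum_le_sum fun k _ => ?_
    rw [← mul_assoc]
    by_cases hk : k = j
    · rw [hk, sign_mul_self]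
    · refine mul_le_mul_of_nonneg_right ?_ (h.offDiag_nonneg k j hk)
      rcases lt_or_gt_of_ne hj with hn | hp
      · rw [sign_neg hn]
        simpa using neg_le_abs (x k)
      · rw [sign_pos hp]
        simpa using le_abs_self (x k)

theorem forward_bound (h : IsLinearlySkipFree Q w c) {D : ℝ → S → ℝ} {M : ℝ}
    (hD : ∀ t, 0 ≤ t → ∀ j, HasDerivWithinAt (fun s => D s j) (∑' k, D t k * Q k j) (Ici t) t)
    (hcont : ∀ j, ContinuousOn (fun t => D t j) (Ici 0))
    (h0 : ∀ j, D 0 j = 0) (hM : ∀ t, 0 ≤ t → ∀ T : Finset S, ∑ k ∈ T, |D t k| ≤ M) {t : ℝ}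
    (ht : 0 ≤ t) {j : S} {N : ℕ} (hj : w j ≤ N) :
    |D t j| * (1 / 2) ^ w j ≤ M * (c * (N + 1) * (1 - Real.exp (-(c * t)) / 2) ^ N) * t := by
  -- The characteristic of $\sigma'=-c(1-\sigma)$ ending at $\sigma(t)=1/2$. On $[0,t]$ it is
  -- bounded by $1-e^{-ct}/2<1$, so the boundary inflow decays geometrically in $N$.
  set σ : ℝ → ℝ := fun u => 1 - Real.exp (-(c * (t - u))) / 2 with hσdef
  have hc := h.rate_nonneg
  have hσ : ∀ u, HasDerivAt σ (-(c * (1 - σ u))) u := by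
    intro u
    refine ((((((hasDerivAt_id u).const_sub t).const_mul c).neg).exp.div_const 2).const_sub
      1).congr_deriv ?_
    simp only [hσdef, id, Pi.neg_apply]
    ring
  have hσle : ∀ u ∈ Icc 0 t, 1 / 2 ≤ σ u ∧ σ u ≤ 1 ∧ σ u ≤ 1 - Real.exp (-(c * t)) / 2 := by
    intro u hu
    have h1 : Real.exp (-(c * (t - u))) ≤ 1 := by
      rw [Real.exp_le_one_iff, neg_nonpos]
      exact mul_nonneg hc (sub_nonneg.2 hu.2)
    have h2 : Real.exp (-(c * t)) ≤ Real.exp (-(c * (t - u))) := by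
      refine Real.exp_le_exp.2 (neg_le_neg (mul_le_mul_of_nonneg_left ?_ hc))
      linarith [hu.1]
    have h3 := Real.exp_pos (-(c * (t - u)))
    refine ⟨?_, ?_, ?_⟩ <;> simp only [hσdef] <;> linarith
  set K : ℝ := M * (c * (N + 1) * (1 - Real.exp (-(c * t)) / 2) ^ N) with hK
  have hM0 : 0 ≤ M := by simpa using hM 0 le_rfl ∅
  set v : ℝ → S → ℝ := fun u j => if D u j = 0 then |∑' k, D u k * Q k j| else
    (SignType.sign (D u j) : ℝ) * ∑' k, D u k * Q k j with hv
  have hmain := image_le_of_deriv_right_le_deriv_boundary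
    (f := fun u => ∑ j ∈ h.level N, |D u j| * σ u ^ w j)
    (f' := fun u => ∑ j ∈ h.level N, (v u j * σ u ^ w j +
      |D u j| * (w j * σ u ^ (w j - 1) * -(c * (1 - σ u)))))
    (a := 0) (b := t) (B := fun u => K * u) (B' := fun _ => K) ?_ ?_ ?_ ?_ ?_ ?_
    (right_mem_Icc.2 ht)
  · refine le_trans ?_ hmain
    refine le_trans ?_ (Finset.single_le_sum (f := fun j => |D t j| * σ t ^ w j)
      (fun k _ => mul_nonneg (abs_nonneg _) (pow_nonneg ?_ _)) (h.mem_level.2 hj))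
    · refine mul_le_mul_of_nonneg_left ?_ (abs_nonneg _)
      exact pow_le_pow_left₀ (by norm_num) (hσle t (right_mem_Icc.2 ht)).1 _
    · linarith [(hσle t (right_mem_Icc.2 ht)).1]
  · refine continuousOn_finsetSum _ fun k _ => ContinuousOn.mul
      ((hcont k).mono Icc_subset_Ici_self).abs (ContinuousOn.pow ?_ _)
    exact fun u _ => (hσ u).continuousAt.continuousWithinAt
  · intro u hu
    refine HasDerivWithinAt.fun_sum fun k _ => ?_
    exact (hD u hu.1 k).abs_Ici.mul ((hσ u).pow (w k)).hasDerivWithinAt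
  · simp [h0]
  · fun_prop
  · intro u _
    simpa using ((hasDerivAt_id u).const_mul K).hasDerivWithinAt
  · intro u hu
    obtain ⟨h1, h2, h3⟩ := hσle u ⟨hu.1, hu.2.le⟩
    have hσ0 : 0 ≤ σ u := by linarith
    have hb := h.sum_sum_mul_pow_le N (x := fun k => |D u k|) (fun k => abs_nonneg _)
      (hM u hu.1) hσ0 h2
    have hvle : ∑ j ∈ h.level N, v u j * σ u ^ w j ≤
        ∑ j ∈ h.level N, (∑ k ∈ h.level (N + 1), |D u k| * Q k j) * σ u ^ w j := by
      refine Finset.sum_le_sum fun k hk => mul_le_mul_of_nonneg_right ?_ (pow_nonneg hσ0 _)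
      simp only [hv, h.tsum_mul_eq_sum (h.mem_level.1 hk)]
      exact h.abs_deriv_le (D u) _ k
    have hKle : M * (c * (N + 1) * σ u ^ N) ≤ K := by
      rw [hK]
      gcongr
    -- The terms coming from $\sigma'$ cancel the transport term in `hb`; only the inflow, at most
    -- $K$, survives.
    rw [Finset.sum_add_distrib]
    simp only [mul_neg, Finset.sum_neg_distrib]
    linarith

/-- A signed `ℓ¹`-bounded solution of the forward equation that starts at zero vanishes. -/
theorem eq_zero_of_forward (h : IsLinearlySkipFree Q w c) {D : ℝ → S → ℝ} {M : ℝ}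
    (hcont : ∀ j, ContinuousOn (fun t => D t j) (Ici 0))
    (hD : ∀ t, 0 < t → ∀ j, HasDerivAt (fun s => D s j) (∑' k, D t k * Q k j) t)
    (h0 : ∀ j, D 0 j = 0) (hM : ∀ t, 0 ≤ t → ∀ T : Finset S, ∑ k ∈ T, |D t k| ≤ M) {t : ℝ}
    (ht : 0 ≤ t) (j : S) : D t j = 0 := by
  -- Derivatives at positive times suffice: the right side is a finite sum of continuous functions,
  -- so its limit at 0 is the right derivative there.
  have hD' : ∀ t, 0 ≤ t → ∀ j,
      HasDerivWithinAt (fun s => D s j) (∑' k, D t k * Q k j) (Ici t) t := by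
    intro t ht j
    rcases ht.eq_or_lt with rfl | ht
    · refine hasDerivWithinAt_Ici_of_tendsto_deriv (s := Ioi 0)
        (fun s hs => (hD s hs j).differentiableAt.differentiableWithinAt)
        ((hcont j 0 self_mem_Ici).mono Ioi_subset_Ici_self) self_mem_nhdsWithin ?_
      rw [h.tsum_mul_eq_sum le_rfl]
      refine (tendsto_finsetSum _ fun k _ => Tendsto.mul_const (Q k j)
        ((hcont k 0 self_mem_Ici).mono Ioi_subset_Ici_self)).congr' ?_
      filter_upwards [self_mem_nhdsWithin] with s hs
      rw [(hD s hs j).deriv, h.tsum_mul_eq_sum le_rfl]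
    · exact (hD t ht j).hasDerivWithinAt
  have hlim : Tendsto (fun N : ℕ => M * (c * (N + 1) * (1 - Real.exp (-(c * t)) / 2) ^ N) * t)
      atTop (𝓝 (M * (c * 0) * t)) := by
    set r := 1 - Real.exp (-(c * t)) / 2 with hr
    have hexp : Real.exp (-(c * t)) ≤ 1 := by
      rw [Real.exp_le_one_iff, neg_nonpos]
      exact mul_nonneg h.rate_nonneg ht
    have hr0 : 0 ≤ r := by linarith
    have hr1 : r < 1 := by linarith [Real.exp_pos (-(c * t))]
    have h1 := tendsto_self_mul_const_pow_of_lt_one hr0 hr1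
    have h2 := tendsto_pow_atTop_nhds_zero_of_lt_one hr0 hr1
    have h3 := h1.add h2
    rw [add_zero] at h3
    refine (((h3.const_mul c).const_mul M).mul_const t).congr fun N => ?_
    ring
  have hle : |D t j| * (1 / 2) ^ w j ≤ M * (c * 0) * t := by
    refine ge_of_tendsto hlim ?_
    filter_upwards [eventually_ge_atTop (w j)] with N hN
    exact h.forward_bound hD' hcont h0 hM ht hN
  rw [mul_zero, mul_zero, zero_mul] at hle
  have hpos : (0 : ℝ) < (1 / 2) ^ w j := by positivity
  exact abs_nonpos_iff.1 (nonpos_of_mul_nonpos_left hle hpos)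

end IsLinearlySkipFree

end Uniqueness

/-! ### The minimal process is the unique transition function solving the forward equation. -/

section TransitionFunction

variable {S : Type*} {Q : Matrix S S ℝ} {w : S → ℕ} {c : ℝ}

theorem SatisfiesForwardEquation.continuousOn {P : ℝ≥0 → Matrix S S ℝ}
    (hP : SatisfiesForwardEquation Q P) (i j : S) :
    ContinuousOn (fun s : ℝ => P s.toNNReal i j) (Ici 0) := fun t ht => by
  have h := (hP t.toNNReal i j).2.continuousWithinAt
  rwa [Real.coe_toNNReal t ht] at h

theorem SatisfiesForwardEquation.hasDerivAt {P : ℝ≥0 → Matrix S S ℝ}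
    (hP : SatisfiesForwardEquation Q P) {t : ℝ} (ht : 0 < t) (i j : S) :
    HasDerivAt (fun s : ℝ => P s.toNNReal i j) (∑' k, P t.toNNReal i k * Q k j) t := by
  have h := (hP t.toNNReal i j).2
  rw [Real.coe_toNNReal t ht.le] at h
  exact h.hasDerivAt (Ici_mem_nhds ht)

theorem sum_abs_sub_le {x y : S → ℝ} (hx : ∀ k, 0 ≤ x k) (hy : ∀ k, 0 ≤ y k) {T : Finset S}
    (hx1 : ∑ k ∈ T, x k ≤ 1) (hy1 : ∑ k ∈ T, y k ≤ 1) : ∑ k ∈ T, |x k - y k| ≤ 2 := by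
  have h : ∑ k ∈ T, |x k - y k| ≤ ∑ k ∈ T, (x k + y k) := by
    refine Finset.sum_le_sum fun k _ => abs_le.2 ⟨?_, ?_⟩ <;> linarith [hx k, hy k]
  rw [Finset.sum_add_distrib] at h
  linarith

variable [DecidableEq S]

theorem IsTransitionFunction.sum_le_one {P : ℝ≥0 → Matrix S S ℝ} (hP : IsTransitionFunction P)
    (t : ℝ≥0) (i : S) (T : Finset S) : ∑ j ∈ T, P t i j ≤ 1 :=
  ((hP.summable t i).sum_le_tsum T fun j _ => hP.nonneg t i j).trans (hP.tsum_le_one t i)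

namespace IsLinearlySkipFree

theorem forward_unique (h : IsLinearlySkipFree Q w c) {P P' : ℝ≥0 → Matrix S S ℝ}
    (hP : IsTransitionFunction P) (hPf : SatisfiesForwardEquation Q P)
    (hP' : IsTransitionFunction P') (hPf' : SatisfiesForwardEquation Q P') : P = P' := by
  funext t
  ext i j
  have key := h.eq_zero_of_forward (M := 2)
    (D := fun s k => P s.toNNReal i k - P' s.toNNReal i k)
    (fun k => (hPf.continuousOn i k).sub (hPf'.continuousOn i k))
    (fun s hs k => ?_) (fun k => ?_) (fun s hs T => ?_) t.2 j
  · have hkey : P (t : ℝ).toNNReal i j - P' (t : ℝ).toNNReal i j = 0 := key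
    rw [Real.toNNReal_coe] at hkey
    exact sub_eq_zero.1 hkey
  · refine ((hPf.hasDerivAt hs i k).sub (hPf'.hasDerivAt hs i k)).congr_deriv ?_
    rw [← (hPf _ i k).1.tsum_sub (hPf' _ i k).1]
    exact tsum_congr fun l => (sub_mul _ _ _).symm
  · simp [hP.zero, hP'.zero]
  · exact sum_abs_sub_le (hP.nonneg _ i) (hP'.nonneg _ i) (hP.sum_le_one _ i T)
      (hP'.sum_le_one _ i T)

variable [Countable S]

theorem satisfiesForwardEquation (h : IsLinearlySkipFree Q w c) :
    SatisfiesForwardEquation Q (fellerMinimal Q) :=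
  satisfiesForwardEquation_fellerMinimal h.offDiag_nonneg h.hasSum_row h.finite_col

theorem fellerMinimal_zero (h : IsLinearlySkipFree Q w c) : fellerMinimal Q 0 = 1 := by
  ext i j
  have h0 := fellerMinimal_eq_integral h.offDiag_nonneg h.hasSum_row
    (C := (h.finite_col j).toFinset) (j := j) (fun k hk => by simpa using hk) i le_rfl
  rw [intervalIntegral.integral_same, Real.toNNReal_zero, mul_zero, Real.exp_zero, add_zero,
    one_mul] at h0
  exact h0

theorem summable_mul_fellerMinimal (h : IsLinearlySkipFree Q w c) (s t : ℝ≥0) (i j : S) :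
    Summable fun k => fellerMinimal Q s i k * fellerMinimal Q t k j :=
  (summable_fellerMinimal h.offDiag_nonneg h.hasSum_row s i).of_nonneg_of_le
    (fun _ => mul_nonneg (fellerMinimal_nonneg _ _ _) (fellerMinimal_nonneg _ _ _))
    fun _ => mul_le_of_le_one_right (fellerMinimal_nonneg _ _ _)
      (fellerMinimal_le_one h.offDiag_nonneg h.hasSum_row _ _ _)

theorem sum_tsum_mul_fellerMinimal_le_one (h : IsLinearlySkipFree Q w c) (s t : ℝ≥0) (i : S)
    (T : Finset S) : ∑ j ∈ T, ∑' k, fellerMinimal Q s i k * fellerMinimal Q t k j ≤ 1 := by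
  have hsum := summable_fellerMinimal h.offDiag_nonneg h.hasSum_row s i
  rw [← Summable.tsum_finsetSum fun j _ => h.summable_mul_fellerMinimal s t i j]
  have hle : ∀ k, ∑ j ∈ T, fellerMinimal Q s i k * fellerMinimal Q t k j ≤
      fellerMinimal Q s i k := fun k => by
    rw [← Finset.mul_sum]
    exact mul_le_of_le_one_right (fellerMinimal_nonneg _ _ _)
      (sum_fellerMinimal_le_one h.offDiag_nonneg h.hasSum_row t k T)
  refine (Summable.tsum_le_tsum hle
    (summable_sum fun j _ => h.summable_mul_fellerMinimal s t i j) hsum).trans ?_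
  exact hsum.tsum_le_of_sum_le
    fun T => sum_fellerMinimal_le_one h.offDiag_nonneg h.hasSum_row s i T

/-- Termwise differentiation, dominated by $f_{ik}(s)\sum_l|q_{lj}|$, which is summable in $k$
because only finitely many $l$ contribute. -/
theorem hasDerivAt_tsum_fellerMinimal (h : IsLinearlySkipFree Q w c) (s : ℝ≥0) (i j : S) {t : ℝ}
    (ht : 0 < t) :
    HasDerivAt (fun u : ℝ => ∑' k, fellerMinimal Q s i k * fellerMinimal Q u.toNNReal k j)
      (∑' l, (∑' k, fellerMinimal Q s i k * fellerMinimal Q t.toNNReal k l) * Q l j) t := by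
  set L := h.level (w j + 1)
  have hsum := summable_fellerMinimal h.offDiag_nonneg h.hasSum_row s i
  have hbound : ∀ k, ∀ u ∈ Ioi (0 : ℝ),
      ‖fellerMinimal Q s i k * ∑' l, fellerMinimal Q u.toNNReal k l * Q l j‖ ≤
        fellerMinimal Q s i k * ∑ l ∈ L, |Q l j| := by
    intro k u _
    rw [h.tsum_mul_eq_sum le_rfl, norm_mul, Real.norm_of_nonneg (fellerMinimal_nonneg _ _ _),
      Real.norm_eq_abs]
    refine mul_le_mul_of_nonneg_left ?_ (fellerMinimal_nonneg _ _ _)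
    refine (Finset.abs_sum_le_sum_abs _ _).trans (Finset.sum_le_sum fun l _ => ?_)
    rw [abs_mul, abs_of_nonneg (fellerMinimal_nonneg _ _ _)]
    exact mul_le_of_le_one_left (abs_nonneg _)
      (fellerMinimal_le_one h.offDiag_nonneg h.hasSum_row _ _ _)
  have hval : ∑' k, fellerMinimal Q s i k * ∑' l, fellerMinimal Q t.toNNReal k l * Q l j =
      ∑' l, (∑' k, fellerMinimal Q s i k * fellerMinimal Q t.toNNReal k l) * Q l j := by
    rw [h.tsum_mul_eq_sum le_rfl]
    simp_rw [← tsum_mul_right]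
    rw [← Summable.tsum_finsetSum fun l _ =>
      (h.summable_mul_fellerMinimal s t.toNNReal i l).mul_right _]
    refine tsum_congr fun k => ?_
    rw [h.tsum_mul_eq_sum le_rfl, Finset.mul_sum]
    exact Finset.sum_congr rfl fun l _ => (mul_assoc _ _ _).symm
  rw [← hval]
  have hd : ∀ k, ∀ u ∈ Ioi (0 : ℝ),
      HasDerivAt (fun u : ℝ => fellerMinimal Q s i k * fellerMinimal Q u.toNNReal k j)
        (fellerMinimal Q s i k * ∑' l, fellerMinimal Q u.toNNReal k l * Q l j) u :=
    fun k u hu => (h.satisfiesForwardEquation.hasDerivAt hu k j).const_mul _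
  have hu := hsum.mul_right (∑ l ∈ L, |Q l j|)
  have hs := h.summable_mul_fellerMinimal s t.toNNReal i j
  have htt : t ∈ Ioi (0 : ℝ) := ht
  exact hasDerivAt_tsum_of_isPreconnected hu isOpen_Ioi isPreconnected_Ioi hd hbound htt hs htt

theorem continuous_fellerMinimal (h : IsLinearlySkipFree Q w c) (i j : S) :
    Continuous fun t : ℝ≥0 => fellerMinimal Q t i j := by
  have hc := (continuous_fellerMinimal_toNNReal h.offDiag_nonneg h.hasSum_row h.finite_col
    i j).comp NNReal.continuous_coe
  refine hc.congr fun t => ?_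
  simp

/-- For fixed $s$ and $i$, both sides are, as functions of $t$, substochastic solutions of the
forward equation with initial row $f_{i\cdot}(s)$, so uniqueness identifies them. -/
theorem fellerMinimal_add (h : IsLinearlySkipFree Q w c) (s t : ℝ≥0) (i j : S) :
    fellerMinimal Q (s + t) i j = ∑' k, fellerMinimal Q s i k * fellerMinimal Q t k j := by
  have hoff := h.offDiag_nonneg
  have hrow := h.hasSum_row
  have key := h.eq_zero_of_forward (M := 2)
    (D := fun u k => fellerMinimal Q (s + u.toNNReal) i k -
      ∑' l, fellerMinimal Q s i l * fellerMinimal Q u.toNNReal l k)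
    (fun k => ContinuousOn.sub ?_ ?_) (fun u hu k => ?_) (fun k => ?_) (fun u _ T => ?_) t.2 j
  · have hkey : fellerMinimal Q (s + (t : ℝ).toNNReal) i j -
      ∑' l, fellerMinimal Q s i l * fellerMinimal Q (t : ℝ).toNNReal l j = 0 := key
    rw [Real.toNNReal_coe] at hkey
    exact sub_eq_zero.1 hkey
  · exact ((h.continuous_fellerMinimal i k).comp
      (continuous_const.add continuous_real_toNNReal)).continuousOn
  · refine continuousOn_tsum (u := fun l => fellerMinimal Q s i l)
      (fun l => ((continuous_fellerMinimal_toNNReal hoff hrow h.finite_col l k).const_mul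
        _).continuousOn) (summable_fellerMinimal hoff hrow s i) fun l u _ => ?_
    rw [norm_mul, Real.norm_of_nonneg (fellerMinimal_nonneg _ _ _),
      Real.norm_of_nonneg (fellerMinimal_nonneg _ _ _)]
    exact mul_le_of_le_one_right (fellerMinimal_nonneg _ _ _) (fellerMinimal_le_one hoff hrow _ _ _)
  · have hadd : ∀ u : ℝ, 0 ≤ u → ((s : ℝ) + u).toNNReal = s + u.toNNReal := fun u hu => by
      rw [Real.toNNReal_add s.coe_nonneg hu, Real.toNNReal_coe]
    have hd1 := (h.satisfiesForwardEquation.hasDerivAt (t := s + u)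
      (add_pos_of_nonneg_of_pos s.coe_nonneg hu) i k).comp_const_add (s : ℝ) u
    have hd1' : HasDerivAt (fun u : ℝ => fellerMinimal Q (s + u.toNNReal) i k)
        (∑' l, fellerMinimal Q (s + u.toNNReal) i l * Q l k) u := by
      rw [hadd u hu.le] at hd1
      refine hd1.congr_of_eventuallyEq ?_
      filter_upwards [Ioi_mem_nhds hu] with v hv
      rw [hadd v (le_of_lt hv)]
    refine (hd1'.sub (h.hasDerivAt_tsum_fellerMinimal s i k hu)).congr_deriv ?_
    rw [h.tsum_mul_eq_sum le_rfl, h.tsum_mul_eq_sum le_rfl, h.tsum_mul_eq_sum le_rfl,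
      ← Finset.sum_sub_distrib]
    exact Finset.sum_congr rfl fun l _ => (sub_mul _ _ _).symm
  · rw [Real.toNNReal_zero, add_zero, h.fellerMinimal_zero, sub_eq_zero, tsum_eq_single k]
    · rw [Matrix.one_apply_eq, mul_one]
    · intro l hl
      rw [Matrix.one_apply_ne hl, mul_zero]
  · exact sum_abs_sub_le (fun k => fellerMinimal_nonneg _ _ _)
      (fun k => tsum_nonneg fun l => mul_nonneg (fellerMinimal_nonneg _ _ _)
        (fellerMinimal_nonneg _ _ _))
      (sum_fellerMinimal_le_one hoff hrow _ i T) (h.sum_tsum_mul_fellerMinimal_le_one s _ i T)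

theorem isTransitionFunction_fellerMinimal (h : IsLinearlySkipFree Q w c) :
    IsTransitionFunction (fellerMinimal Q) where
  nonneg := fellerMinimal_nonneg
  summable := summable_fellerMinimal h.offDiag_nonneg h.hasSum_row
  tsum_le_one t i := (summable_fellerMinimal h.offDiag_nonneg h.hasSum_row t i).tsum_le_of_sum_le
    (sum_fellerMinimal_le_one h.offDiag_nonneg h.hasSum_row t i)
  zero := h.fellerMinimal_zero
  chapman_kolmogorov := h.fellerMinimal_add
  standard i j := by
    rw [← h.fellerMinimal_zero]
    exact (h.continuous_fellerMinimal i j).continuousWithinAt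

end IsLinearlySkipFree

end TransitionFunction

/-! ### Branching with immigration matrices are linearly skip-free. -/

section BranchingImmigration

theorem IsConservativeRate.hasSum_zero {S : Type*} {r : S → ℝ} {x : S}
    (hr : IsConservativeRate r x) : HasSum r 0 := by
  have h1 : HasSum (r ∘ ((↑) : ({x} : Set S) → S)) (r x) := by
    simpa using hasSum_unique (r ∘ ((↑) : ({x} : Set S) → S))
  have h2 : HasSum (r ∘ ((↑) : (({x} : Set S)ᶜ : Set S) → S)) (-r x) := hr.2.2
  simpa using h1.add_compl h2

variable {n : ℕ}

theorem sum_unitVec (k : Fin n) : ∑ l, unitVec k l = 1 := by simp [unitVec]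

theorem unitVec_le {k : Fin n} {i : NTState n} (hk : i k ≠ 0) (l : Fin n) :
    unitVec k l ≤ i l := by
  rw [unitVec, Pi.single_apply]
  split_ifs with h
  · subst h
    omega
  · omega

/-- Since $e\le i$, the shift $m\mapsto m+(i-e)$ is injective with range exactly the indices where
the summand is not cut off. -/
theorem hasSum_translate {r : NTState n → ℝ} {x : ℝ} (hr : HasSum r x) {i e : NTState n}
    (he : ∀ l, e l ≤ i l) :
    HasSum (fun j => if ∀ l, i l ≤ (j + e) l then r (j + e - i) else 0) x := by
  have hinj : Function.Injective fun m : NTState n => m + (i - e) := add_left_injective _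
  refine (hinj.hasSum_iff fun j hj => if_neg fun hle => hj ⟨j + e - i, ?_⟩).1 ?_
  · funext l
    have h1 := hle l
    have h2 := he l
    simp only [Pi.add_apply, Pi.sub_apply] at h1 ⊢
    omega
  · convert hr using 1
    funext m
    have hm : m + (i - e) + e = m + i := by
      funext l
      have := he l
      simp only [Pi.add_apply, Pi.sub_apply]
      omega
    simp only [Function.comp_apply, hm]
    rw [if_pos fun l => by simp, add_tsub_cancel_right]

theorem eq_of_add_sub_eq {i j e : NTState n} (hle : ∀ l, i l ≤ (j + e) l) (h : j + e - i = e) :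
    i = j := by
  funext l
  have h1 := hle l
  have h2 := congrFun h l
  simp only [Pi.add_apply, Pi.sub_apply] at h1 h2
  omega

variable {h a : NTState n → ℝ} {b : Fin n → NTState n → ℝ}

theorem ntbiMatrix_zero (j : NTState n) : ntbiMatrix h a b 0 j = h j := if_pos rfl

/-- Writing immigration as a translate by $0$ lets branching and immigration share the translation
lemmas. -/
theorem ntbiMatrix_of_ne_zero {i : NTState n} (hi : i ≠ 0) (j : NTState n) :
    ntbiMatrix h a b i j =
      (∑ k, (i k : ℝ) *
        (if ∀ l, i l ≤ (j + unitVec k) l then b k (j + unitVec k - i) else 0)) +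
      (if ∀ l, i l ≤ (j + 0) l then a (j + 0 - i) else 0) := by
  rw [add_zero]
  exact if_neg hi

theorem translate_nonneg {r : NTState n → ℝ} {i j e : NTState n} (hr : ∀ j, j ≠ e → 0 ≤ r j)
    (hij : i ≠ j) : 0 ≤ if ∀ l, i l ≤ (j + e) l then r (j + e - i) else 0 := by
  split_ifs with hle
  · exact hr _ fun he => hij (eq_of_add_sub_eq hle he)
  · exact le_rfl

/-- One branching event removes one individual, while immigration, and resurrection from $\mathbf
0$, never decrease the population. Type $k$ branches at rate $-i_k b^{(k)}_{\mathbf e_k}$, at most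
$i_k$ times the sum of all the individual rates. -/
theorem isLinearlySkipFree_ntbiMatrix (hh : IsConservativeRate h 0) (ha : IsConservativeRate a 0)
    (hb : ∀ k, IsConservativeRate (b k) (unitVec k)) :
    IsLinearlySkipFree (ntbiMatrix h a b) (fun i => ∑ l, i l) (∑ k, -b k (unitVec k)) where
  offDiag_nonneg i j hij := by
    by_cases hi : i = 0
    · subst hi
      rw [ntbiMatrix_zero]
      exact hh.1 j hij.symm
    · rw [ntbiMatrix_of_ne_zero hi]
      exact add_nonneg (Finset.sum_nonneg fun k _ => mul_nonneg (Nat.cast_nonneg _)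
        (translate_nonneg (hb k).1 hij)) (translate_nonneg ha.1 hij)
  hasSum_row i := by
    by_cases hi : i = 0
    · subst hi
      exact hh.hasSum_zero.congr_fun fun j => ntbiMatrix_zero j
    · have hB : ∀ k ∈ Finset.univ, HasSum (fun j : NTState n => (i k : ℝ) *
          (if ∀ l, i l ≤ (j + unitVec k) l then b k (j + unitVec k - i) else 0)) 0 := by
        intro k _
        by_cases hk : i k = 0
        · simp [hk, hasSum_zero]
        · simpa using (hasSum_translate (hb k).hasSum_zero (unitVec_le hk)).mul_left (i k : ℝ)
      have hs := (hasSum_sum hB).add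
        (hasSum_translate ha.hasSum_zero (i := i) (e := 0) fun l => Nat.zero_le _)
      rw [Finset.sum_const_zero, add_zero] at hs
      exact hs.congr_fun fun j => ntbiMatrix_of_ne_zero hi j
  finite_level N := by
    refine (Set.finite_Iic (fun _ : Fin n => N)).subset fun j hj l => ?_
    exact (Finset.single_le_sum (fun k _ => Nat.zero_le (j k)) (Finset.mem_univ l)).trans hj
  weight_le i j hij := by
    by_cases hi : i = 0
    · simp [hi]
    · by_contra hlt
      refine hij ?_
      have hw : ∀ e : NTState n, ∑ l, e l ≤ 1 → ¬ ∀ l, i l ≤ (j + e) l := fun e he hle => by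
        have := Finset.sum_le_sum fun l (_ : l ∈ Finset.univ) => hle l
        simp only [Pi.add_apply, Finset.sum_add_distrib] at this
        omega
      rw [ntbiMatrix_of_ne_zero hi, if_neg (hw 0 (by simp)), add_zero]
      exact Finset.sum_eq_zero fun k _ => by rw [if_neg (hw _ (sum_unitVec k).le), mul_zero]
  rate_nonneg := Finset.sum_nonneg fun k _ => (hb k).2.1.le
  sum_down_le i T hT := by
    by_cases hi : i = 0
    · have : T = ∅ := Finset.eq_empty_of_forall_notMem fun j hj => by simpa [hi] using hT j hj
      simp [this, hi]
    · have hiT : i ∉ T := fun hiT => lt_irrefl _ (hT i hiT)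
      have hA : ∀ j ∈ T, ntbiMatrix h a b i j = ∑ k, (i k : ℝ) *
          (if ∀ l, i l ≤ (j + unitVec k) l then b k (j + unitVec k - i) else 0) := by
        intro j hj
        rw [ntbiMatrix_of_ne_zero hi, if_neg, add_zero]
        intro hle
        have := Finset.sum_le_sum fun l (_ : l ∈ Finset.univ) => hle l
        rw [add_zero] at this
        exact absurd (hT j hj) (not_lt.2 this)
      rw [Finset.sum_congr rfl hA, Finset.sum_comm]
      push_cast
      rw [Finset.mul_sum]
      refine Finset.sum_le_sum fun k _ => ?_
      rw [← Finset.mul_sum, mul_comm (∑ k, -b k (unitVec k))]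
      -- An absent type has zero coefficient; it is separated because translation requires $\mathbf
      -- e_k\le i$.
      by_cases hk : i k = 0
      · simp [hk]
      refine mul_le_mul_of_nonneg_left ?_ (Nat.cast_nonneg _)
      refine le_trans ?_ (Finset.single_le_sum (f := fun k => -b k (unitVec k))
        (fun k _ => (hb k).2.1.le) (Finset.mem_univ k))
      -- The translated branching row sums to zero and is nonnegative off $i$, so its sum over $T$
      -- is at most minus its entry at $i$, which is $-b^{(k)}_{\mathbf e_k}$.
      have hs := sum_le_hasSum (insert i T)
        (fun j hj => translate_nonneg (hb k).1 
          (ne_of_mem_of_not_mem (Finset.mem_insert_self i T) hj))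
        (hasSum_translate (hb k).hasSum_zero (unitVec_le hk))
      rw [Finset.sum_insert hiT, if_pos fun l => by simp, add_tsub_cancel_left] at hs
      linarith

end BranchingImmigration

end

theorem theorem2p1 {n : ℕ} (Q : Matrix (NTState n) (NTState n) ℝ) (hQ : IsNTBIMatrix Q) :
    (∃! P : ℝ≥0 → Matrix (NTState n) (NTState n) ℝ, IsNTBIP Q P) ∧
      IsNTBIP Q (fellerMinimal Q) := by
  obtain ⟨h, a, b, hh, ha, hb, rfl⟩ := id hQ
  have hskip := isLinearlySkipFree_ntbiMatrix hh ha hb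
  have hF : IsNTBIP (ntbiMatrix h a b) (fellerMinimal (ntbiMatrix h a b)) :=
    ⟨hQ, hskip.isTransitionFunction_fellerMinimal, hskip.satisfiesForwardEquation⟩
  exact ⟨⟨_, hF, fun P hP => hskip.forward_unique hP.2.1 hP.2.2 hF.2.1 hF.2.2⟩, hF⟩
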